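/- Let $(N^n,g)$ be a smooth Riemannian manifold with an almost contact metric structure $(\xi,\eta,\varphi)$: $\xi$ is a smooth unit vector field, $\eta=g(\xi,\cdot)$, and $\varphi\colon TN\to TN$ is a smooth bundle endomorphism with $$\varphi(\xi)=0,\qquad \varphi^2=-1+\eta\otimes\xi,\qquad g(\varphi X,\varphi Y)=g(X,Y)-\eta(X)\eta(Y)$$ (so $n$ is odd). Write $d\eta(X,Y)=X\eta(Y)-Y\eta(X)-\eta([X,Y])$, $F=g(\varphi\,\cdot,\cdot)$, $d^\varphi F(X,Y,Z)=dF(\varphi X,\varphi Y,\varphi Z)$, and let $$c=\eta\wedge d\eta+d^\varphi F,\qquad (\eta\wedge d\eta)(X,Y,Z)=\eta(X)d\eta(Y,Z)+\eta(Y)d\eta(Z,X)+\eta(Z)d\eta(X,Y).$$ Assume that the structure is normal, i.e. for all vector fields $X,Y$ $$[\varphi X,\varphi Y]+\varphi^2[X,Y]-\varphi[\varphi X,Y]-\varphi[X,\varphi Y]+d\eta(X,Y)\,\xi=0.$$ Call $N$ an ST manifold (Sasaki with torsion) if, in addition, $\xi$ is a Killing vector field, $\mathcal L_\xi g=0$.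 Call a smooth connection $D$ on $TN$ an almost contact metric connection if $Dg=0$, $D\xi=0$ and $D\varphi=0$. Let $\nabla^{LC}$ be the Levi-Civita connection and define the connection $\nabla$ by $$g(\nabla_XY,Z)=g(\nabla^{LC}_XY,Z)+\tfrac12\,c(X,Y,Z).$$ **Proposition.** (1) $N$ is an ST manifold if and only if $\nabla$ is an almost contact metric connection. (2) $N$ is an ST manifold if and only if there is an almost contact metric connection $D$ on $N$ with skew torsion, i.e. such that $(X,Y,Z)\mapsto g(D_XY-D_YX-[X,Y],Z)$ is totally skew-symmetric. -/

import Mathlib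

open Bundle VectorField FiberBundle
open scoped Manifold ContDiff

namespace SasakiTorsion

set_option linter.unusedSectionVars false

noncomputable section

variable {E : Type*} [NormedAddCommGroup E] [NormedSpace ℝ E] [FiniteDimensional ℝ E]
  [CompleteSpace E]
  {H : Type*} [TopologicalSpace H] {I : ModelWithCorners ℝ E H}
  {M : Type*} [TopologicalSpace M] [ChartedSpace H M] [IsManifold I ∞ M]
  [RiemannianBundle (fun x : M ↦ TangentSpace I x)]
  [IsContMDiffRiemannianBundle I ∞ E (fun x : M ↦ TangentSpace I x)]

/-- The Koszul expression, which is `2 g(∇_X Y, Z)` for the Levi-Civita connection `∇`. -/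
def koszul (X Y Z : Π x : M, TangentSpace I x) (x : M) : ℝ :=
  d% (fun y ↦ inner ℝ (Y y) (Z y)) x (X x) + d% (fun y ↦ inner ℝ (X y) (Z y)) x (Y x)
    - d% (fun y ↦ inner ℝ (X y) (Y y)) x (Z x)
    + inner ℝ (mlieBracket I X Y x) (Z x) - inner ℝ (mlieBracket I X Z x) (Y x)
    - inner ℝ (mlieBracket I Y Z x) (X x)

theorem mdifferentiableAt_inner {x : M} {X Y : Π x : M, TangentSpace I x}
    (hX : MDiffAt (T% X) x) (hY : MDiffAt (T% Y) x) :
    MDiffAt (fun y ↦ inner ℝ (X y) (Y y)) x :=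
  MDifferentiableAt.inner_bundle (E := fun x : M ↦ TangentSpace I x) (b := id) hX hY

theorem koszul_tensorial_left {x : M} {Y Z : Π x : M, TangentSpace I x}
    (hY : MDiffAt (T% Y) x) (hZ : MDiffAt (T% Z) x) :
    TensorialAt I E (fun X ↦ koszul X Y Z x) x where
  smul {f X} hf hX := by
    simp only [koszul, mlieBracket_smul_left hf hX, Pi.smul_apply', inner_add_left,
      real_inner_smul_left]
    rw [mvfderiv_fun_mul hf (mdifferentiableAt_inner hX hZ),
      mvfderiv_fun_mul hf (mdifferentiableAt_inner hX hY)]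
    simp [real_inner_smul_right]
    ring
  add {X X'} hX hX' := by
    simp only [koszul, mlieBracket_add_left hX hX', Pi.add_apply, inner_add_left, inner_add_right]
    rw [mvfderiv_fun_add (mdifferentiableAt_inner hX hZ) (mdifferentiableAt_inner hX' hZ),
      mvfderiv_fun_add (mdifferentiableAt_inner hX hY) (mdifferentiableAt_inner hX' hY)]
    simp
    ring

theorem koszul_tensorial_right {x : M} {X Y : Π x : M, TangentSpace I x}
    (hX : MDiffAt (T% X) x) (hY : MDiffAt (T% Y) x) :
    TensorialAt I E (fun Z ↦ koszul X Y Z x) x where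
  smul {f Z} hf hZ := by
    simp only [koszul, mlieBracket_smul_right hf hZ, Pi.smul_apply', inner_add_left,
      real_inner_smul_left, real_inner_smul_right]
    rw [mvfderiv_fun_mul hf (mdifferentiableAt_inner hY hZ),
      mvfderiv_fun_mul hf (mdifferentiableAt_inner hX hZ)]
    simp [real_inner_comm]
    ring
  add {Z Z'} hZ hZ' := by
    simp only [koszul, mlieBracket_add_right hZ hZ', Pi.add_apply, inner_add_left, inner_add_right]
    rw [mvfderiv_fun_add (mdifferentiableAt_inner hY hZ) (mdifferentiableAt_inner hY hZ'),
      mvfderiv_fun_add (mdifferentiableAt_inner hX hZ) (mdifferentiableAt_inner hX hZ')]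
    simp
    ring

theorem koszul_add_mid {x : M} {X Y Y' Z : Π x : M, TangentSpace I x}
    (hX : MDiffAt (T% X) x) (hY : MDiffAt (T% Y) x) (hY' : MDiffAt (T% Y') x)
    (hZ : MDiffAt (T% Z) x) :
    koszul X (Y + Y') Z x = koszul X Y Z x + koszul X Y' Z x := by
  simp only [koszul, mlieBracket_add_right hY hY', mlieBracket_add_left hY hY', Pi.add_apply,
    inner_add_left, inner_add_right]
  rw [mvfderiv_fun_add (mdifferentiableAt_inner hY hZ) (mdifferentiableAt_inner hY' hZ),
    mvfderiv_fun_add (mdifferentiableAt_inner hX hY) (mdifferentiableAt_inner hX hY')]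
  simp
  ring

theorem koszul_smul_mid {x : M} {f : M → ℝ} {X Y Z : Π x : M, TangentSpace I x}
    (hf : MDiffAt f x) (hX : MDiffAt (T% X) x) (hY : MDiffAt (T% Y) x) (hZ : MDiffAt (T% Z) x) :
    koszul X (f • Y) Z x = f x * koszul X Y Z x + 2 * (d% f x (X x)) * inner ℝ (Y x) (Z x) := by
  simp only [koszul, mlieBracket_smul_right hf hY, mlieBracket_smul_left hf hY, Pi.smul_apply',
    inner_add_left, real_inner_smul_left, real_inner_smul_right]
  rw [mvfderiv_fun_mul hf (mdifferentiableAt_inner hY hZ),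
    mvfderiv_fun_mul hf (mdifferentiableAt_inner hX hY)]
  simp [real_inner_comm]
  ring

instance finiteDimensional_tangentSpace (x : M) : FiniteDimensional ℝ (TangentSpace I x) :=
  inferInstanceAs (FiniteDimensional ℝ E)

instance completeSpace_tangentSpace (x : M) : CompleteSpace (TangentSpace I x) :=
  FiniteDimensional.complete ℝ (TangentSpace I x)

/-- The vector representing a linear form on a tangent space through the metric. -/
def sharp (x : M) : (TangentSpace I x →L[ℝ] ℝ) →L[ℝ] TangentSpace I x :=
  LinearMap.toContinuousLinearMap
    { toFun := fun α ↦ (InnerProductSpace.toDual ℝ (TangentSpace I x)).symm α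
      map_add' := fun α β ↦ map_add _ α β
      map_smul' := fun c α ↦ by simp }

theorem inner_sharp (x : M) (α : TangentSpace I x →L[ℝ] ℝ) (v : TangentSpace I x) :
    inner ℝ (sharp x α) v = α v :=
  InnerProductSpace.toDual_symm_apply (𝕜 := ℝ) (E := TangentSpace I x)

open Classical in
/-- The Levi-Civita derivative `u ↦ ∇_u Y` at `x`; on a field that is not differentiable at `x` it
is zero. -/
def leviCivitaFun (Y : Π x : M, TangentSpace I x) (x : M) :
    TangentSpace I x →L[ℝ] TangentSpace I x :=
  if hY : MDiffAt (T% Y) x then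
    (2⁻¹ : ℝ) • (sharp x ∘L TensorialAt.mkHom₂ (fun X Z ↦ koszul X Y Z x) x
      (fun _ hZ ↦ koszul_tensorial_left hY hZ) (fun _ hX ↦ koszul_tensorial_right hX hY))
  else 0

theorem inner_leviCivitaFun {x : M} {X Y Z : Π x : M, TangentSpace I x}
    (hX : MDiffAt (T% X) x) (hY : MDiffAt (T% Y) x) (hZ : MDiffAt (T% Z) x) :
    inner ℝ (leviCivitaFun Y x (X x)) (Z x) = koszul X Y Z x / 2 := by
  have := TensorialAt.mkHom₂_apply (Φ := fun X Z ↦ koszul X Y Z x) (x := x)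
      (fun _ hZ ↦ koszul_tensorial_left hY hZ) (fun _ hX ↦ koszul_tensorial_right hX hY) hX hZ
  simp [leviCivitaFun, hY, real_inner_smul_left, inner_sharp, this]
  ring

theorem ext_fields {x : M} {A B : TangentSpace I x →L[ℝ] TangentSpace I x}
    (h : ∀ X Z : Π x : M, TangentSpace I x, MDiffAt (T% X) x → MDiffAt (T% Z) x →
      inner ℝ (A (X x)) (Z x) = inner ℝ (B (X x)) (Z x)) : A = B := by
  ext u
  refine ext_inner_right ℝ fun v ↦ ?_
  simpa using h (extend E u) (extend E v) (mdifferentiableAt_extend ..)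
    (mdifferentiableAt_extend ..)

variable (I M) in
/-- The Levi-Civita connection. -/
def leviCivita : CovariantDerivative I E (fun x : M ↦ TangentSpace I x) where
  toFun := leviCivitaFun
  isCovariantDerivativeOnUniv :=
    { add := fun {Y Y' x} hY hY' _ ↦ by
        refine ext_fields fun X Z hX hZ ↦ ?_
        simp [inner_leviCivitaFun hX (mdifferentiableAt_add_section hY hY') hZ,
          inner_add_left, inner_leviCivitaFun hX hY hZ,
          inner_leviCivitaFun hX hY' hZ, koszul_add_mid hX hY hY' hZ]
        ring
      leibniz := fun {Y f x} hY hf _ ↦ by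
        refine ext_fields fun X Z hX hZ ↦ ?_
        simp [inner_leviCivitaFun hX (hf.smul_section hY) hZ, inner_leviCivitaFun hX hY hZ,
          inner_add_left, real_inner_smul_left, koszul_smul_mid hf hX hY hZ]
        ring }

theorem inner_leviCivita {x : M} {X Y Z : Π x : M, TangentSpace I x}
    (hX : MDiffAt (T% X) x) (hY : MDiffAt (T% Y) x) (hZ : MDiffAt (T% Z) x) :
    inner ℝ (leviCivita I M Y x (X x)) (Z x) = koszul X Y Z x / 2 :=
  inner_leviCivitaFun hX hY hZ

/-- The connection `D` preserves the metric: `X g(Y, Z) = g(D_X Y, Z) + g(Y, D_X Z)`. -/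
def PreservesMetric (D : CovariantDerivative I E (fun x : M ↦ TangentSpace I x)) : Prop :=
  ∀ (x : M) (X Y Z : Π y : M, TangentSpace I y),
    MDiffAt (T% X) x → MDiffAt (T% Y) x → MDiffAt (T% Z) x →
    d% (fun y ↦ inner ℝ (Y y) (Z y)) x (X x)
      = inner ℝ (D Y x (X x)) (Z x) + inner ℝ (Y x) (D Z x (X x))

theorem leviCivita_preservesMetric : PreservesMetric (leviCivita I M) := by
  intro x X Y Z hX hY hZ
  have h := inner_leviCivita hX hZ hY
  rw [real_inner_comm] at h
  rw [inner_leviCivita hX hY hZ, h]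
  have e1 : (fun y ↦ inner ℝ (Z y) (Y y)) = (fun y ↦ inner ℝ (Y y) (Z y)) := by
    ext y; exact real_inner_comm _ _
  simp only [koszul, mlieBracket_swap_apply (V := Z) (W := Y), e1]
  simp
  ring

theorem leviCivita_torsion : (leviCivita I M).torsion = 0 := by
  rw [CovariantDerivative.torsion_eq_zero_iff]
  intro X Y x hX hY
  refine ext_inner_right ℝ fun v ↦ ?_
  have hv : MDiffAt (T% (extend E v : Π y : M, TangentSpace I y)) x :=
    mdifferentiableAt_extend ..
  have h1 := inner_leviCivita hX hY hv
  have h2 := inner_leviCivita hY hX hv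
  simp only [extend_apply_self] at h1 h2
  have e1 : (fun y ↦ inner ℝ (Y y) (X y)) = (fun y ↦ inner ℝ (X y) (Y y)) := by
    ext y; exact real_inner_comm _ _
  rw [inner_sub_left, h1, h2]
  simp only [koszul, mlieBracket_swap_apply (V := Y) (W := X), e1]
  simp
  ring

/-! ### Exterior derivatives of forms, by the invariant formula -/

/-- The exterior derivative `dα(X, Y) = X α(Y) - Y α(X) - α([X, Y])` of a 1-form at `x`. -/
def extDerivOne (α : Π x : M, TangentSpace I x →L[ℝ] ℝ) (X Y : Π x : M, TangentSpace I x)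
    (x : M) : ℝ :=
  d% (fun y ↦ α y (Y y)) x (X x) - d% (fun y ↦ α y (X y)) x (Y x) - α x (mlieBracket I X Y x)

/-- The exterior derivative of a 2-form `β` at `x`: `dβ(X, Y, Z)` is the cyclic sum of
`X β(Y, Z) - β([X, Y], Z)`. -/
def extDerivTwo (β : Π x : M, TangentSpace I x →L[ℝ] TangentSpace I x →L[ℝ] ℝ)
    (X Y Z : Π x : M, TangentSpace I x) (x : M) : ℝ :=
  d% (fun y ↦ β y (Y y) (Z y)) x (X x) + d% (fun y ↦ β y (Z y) (X y)) x (Y x)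
    + d% (fun y ↦ β y (X y) (Y y)) x (Z x)
    - β x (mlieBracket I X Y x) (Z x) - β x (mlieBracket I Y Z x) (X x)
    - β x (mlieBracket I Z X x) (Y x)

theorem extDerivOne_tensorial {α : Π x : M, TangentSpace I x →L[ℝ] ℝ} {x : M}
    (hα : ∀ Y : Π x : M, TangentSpace I x, MDiffAt (T% Y) x → MDiffAt (fun y ↦ α y (Y y)) x)
    (Y : Π x : M, TangentSpace I x) :
    TensorialAt I E (fun X ↦ extDerivOne α X Y x) x where
  smul {f X} hf hX := by
    simp only [extDerivOne, mlieBracket_smul_left hf hX, Pi.smul_apply', map_add, map_smul,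
      smul_eq_mul]
    rw [mvfderiv_fun_mul hf (hα X hX)]
    simp
    ring
  add {X X'} hX hX' := by
    simp only [extDerivOne, mlieBracket_add_left hX hX', Pi.add_apply, map_add]
    rw [mvfderiv_fun_add (hα X hX) (hα X' hX')]
    simp
    ring

theorem extDerivOne_swap (α : Π x : M, TangentSpace I x →L[ℝ] ℝ)
    (X Y : Π x : M, TangentSpace I x) (x : M) :
    extDerivOne α X Y x = - extDerivOne α Y X x := by
  simp only [extDerivOne, mlieBracket_swap_apply (V := X) (W := Y), map_neg]
  ring

theorem extDerivTwo_cyclic (β : Π x : M, TangentSpace I x →L[ℝ] TangentSpace I x →L[ℝ] ℝ)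
    (X Y Z : Π x : M, TangentSpace I x) (x : M) :
    extDerivTwo β X Y Z x = extDerivTwo β Y Z X x := by
  simp only [extDerivTwo]
  ring

theorem extDerivTwo_tensorial
    {β : Π x : M, TangentSpace I x →L[ℝ] TangentSpace I x →L[ℝ] ℝ} {x : M}
    (hβ : ∀ Y Z : Π x : M, TangentSpace I x, MDiffAt (T% Y) x → MDiffAt (T% Z) x →
      MDiffAt (fun y ↦ β y (Y y) (Z y)) x) (hβ' : ∀ y u v, β y u v = - β y v u)
    {Y Z : Π x : M, TangentSpace I x} (hY : MDiffAt (T% Y) x) (hZ : MDiffAt (T% Z) x) :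
    TensorialAt I E (fun X ↦ extDerivTwo β X Y Z x) x where
  smul {f X} hf hX := by
    simp only [extDerivTwo, mlieBracket_smul_left hf hX, mlieBracket_smul_right hf hX,
      Pi.smul_apply', map_add, map_smul, smul_eq_mul, _root_.add_apply,
      _root_.smul_apply]
    rw [mvfderiv_fun_mul hf (hβ Z X hZ hX), mvfderiv_fun_mul hf (hβ X Y hX hY)]
    simp
    rw [hβ' x (Z x) (X x)]
    ring
  add {X X'} hX hX' := by
    simp only [extDerivTwo, mlieBracket_add_left hX hX', mlieBracket_add_right hX hX',
      Pi.add_apply, map_add, _root_.add_apply]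
    rw [mvfderiv_fun_add (hβ Z X hZ hX) (hβ Z X' hZ hX'),
      mvfderiv_fun_add (hβ X Y hX hY) (hβ X' Y hX' hY)]
    simp
    ring

set_option synthInstance.maxHeartbeats 400000 in
open Classical in
/-- The trilinear form on `T_x M` given by an operation that is tensorial in each argument. -/
def trilinearOfTensorial (Φ : (Π x : M, TangentSpace I x) → (Π x : M, TangentSpace I x) →
      (Π x : M, TangentSpace I x) → ℝ) (x : M)
    (h₁ : ∀ Y Z, MDiffAt (T% Y) x → MDiffAt (T% Z) x → TensorialAt I E (fun X ↦ Φ X Y Z) x)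
    (h₂ : ∀ X Z, MDiffAt (T% X) x → MDiffAt (T% Z) x → TensorialAt I E (fun Y ↦ Φ X Y Z) x)
    (h₃ : ∀ X Y, MDiffAt (T% X) x → MDiffAt (T% Y) x → TensorialAt I E (fun Z ↦ Φ X Y Z) x) :
    TangentSpace I x →L[ℝ] TangentSpace I x →L[ℝ] TangentSpace I x →L[ℝ] ℝ :=
  TensorialAt.mkHom (I := I) (F := E)
    (fun X ↦ if hX : MDiffAt (T% X) x then
      TensorialAt.mkHom₂ (Φ X) x (fun Z hZ ↦ h₂ X Z hX hZ) (fun Y hY ↦ h₃ X Y hX hY) else 0) x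
    { smul := fun {f X} hf hX ↦ by
        rw [dif_pos (hf.smul_section hX), dif_pos hX]
        ext v w
        exact (h₁ _ _ (mdifferentiableAt_extend ..) (mdifferentiableAt_extend ..)).smul hf hX
      add := fun {X X'} hX hX' ↦ by
        rw [dif_pos (mdifferentiableAt_add_section hX hX'), dif_pos hX, dif_pos hX']
        ext v w
        exact (h₁ _ _ (mdifferentiableAt_extend ..) (mdifferentiableAt_extend ..)).add hX hX' }

set_option synthInstance.maxHeartbeats 400000 in
theorem trilinearOfTensorial_apply {Φ : (Π x : M, TangentSpace I x) →
      (Π x : M, TangentSpace I x) → (Π x : M, TangentSpace I x) → ℝ} {x : M}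
    (h₁ : ∀ Y Z, MDiffAt (T% Y) x → MDiffAt (T% Z) x → TensorialAt I E (fun X ↦ Φ X Y Z) x)
    (h₂ : ∀ X Z, MDiffAt (T% X) x → MDiffAt (T% Z) x → TensorialAt I E (fun Y ↦ Φ X Y Z) x)
    (h₃ : ∀ X Y, MDiffAt (T% X) x → MDiffAt (T% Y) x → TensorialAt I E (fun Z ↦ Φ X Y Z) x)
    {X Y Z : Π x : M, TangentSpace I x}
    (hX : MDiffAt (T% X) x) (hY : MDiffAt (T% Y) x) (hZ : MDiffAt (T% Z) x) :
    trilinearOfTensorial Φ x h₁ h₂ h₃ (X x) (Y x) (Z x) = Φ X Y Z := by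
  unfold trilinearOfTensorial
  rw [TensorialAt.mkHom_apply _ hX, dif_pos hX]
  exact TensorialAt.mkHom₂_apply _ _ hY hZ

/-! ### Almost contact metric structures -/

variable (I M) in
/-- An almost contact metric structure `(ξ, η, φ)` on the Riemannian manifold `(M, g)`; the 1-form
`η = g(ξ, ·)` is determined by `ξ`, see `AlmostContactMetric.η`. -/
structure AlmostContactMetric where
  /-- The Reeb vector field. -/
  ξ : Π x : M, TangentSpace I x
  /-- The bundle endomorphism. -/
  φ : Π x : M, TangentSpace I x →L[ℝ] TangentSpace I x
  contMDiff_ξ : CMDiff ∞ (T% ξ)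
  contMDiff_φ : ContMDiff I (I.prod 𝓘(ℝ, E →L[ℝ] E)) ∞
    (fun x ↦ TotalSpace.mk' (E →L[ℝ] E)
      (E := fun x : M ↦ TangentSpace I x →L[ℝ] TangentSpace I x) x (φ x))
  norm_ξ : ∀ x, ‖ξ x‖ = 1
  φ_ξ : ∀ x, φ x (ξ x) = 0
  φ_φ : ∀ x (v : TangentSpace I x), φ x (φ x v) = -v + inner ℝ (ξ x) v • ξ x
  inner_φ_φ : ∀ x (v w : TangentSpace I x),
    inner ℝ (φ x v) (φ x w) = inner ℝ v w - inner ℝ (ξ x) v * inner ℝ (ξ x) w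

namespace AlmostContactMetric

variable (S : AlmostContactMetric I M)

/-- The 1-form `η = g(ξ, ·)`. -/
def η (x : M) : TangentSpace I x →L[ℝ] ℝ := innerSL ℝ (S.ξ x)

/-- The fundamental 2-form `F = g(φ ·, ·)`. -/
def F (x : M) : TangentSpace I x →L[ℝ] TangentSpace I x →L[ℝ] ℝ := innerSL ℝ ∘L S.φ x

/-- The vector field `φ X`. -/
def φField (X : Π x : M, TangentSpace I x) (x : M) : TangentSpace I x := S.φ x (X x)

/-- The Sasaki-Hatakeyama tensor evaluated on vector fields. -/
def sasakiHatakeyama (X Y : Π x : M, TangentSpace I x) (x : M) : TangentSpace I x :=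
  mlieBracket I (S.φField X) (S.φField Y) x + S.φ x (S.φ x (mlieBracket I X Y x))
    - S.φ x (mlieBracket I (S.φField X) Y x) - S.φ x (mlieBracket I X (S.φField Y) x)
    + extDerivOne S.η X Y x • S.ξ x

/-- The structure is normal: the Sasaki-Hatakeyama tensor vanishes. -/
def IsNormal : Prop :=
  ∀ (x : M) (X Y : Π y : M, TangentSpace I y), MDiffAt (T% X) x → MDiffAt (T% Y) x →
    S.sasakiHatakeyama X Y x = 0

/-- The torsion 3-form `c = η ∧ dη + d^φ F`, where `d^φ F = dF(φ ·, φ ·, φ ·)`, evaluated on vector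
fields. -/
def torsionForm (X Y Z : Π x : M, TangentSpace I x) (x : M) : ℝ :=
  (S.η x (X x) * extDerivOne S.η Y Z x + S.η x (Y x) * extDerivOne S.η Z X x
    + S.η x (Z x) * extDerivOne S.η X Y x)
  + extDerivTwo S.F (S.φField X) (S.φField Y) (S.φField Z) x

theorem mdifferentiableAt_φField {x : M} {X : Π x : M, TangentSpace I x}
    (hX : MDiffAt (T% X) x) : MDiffAt (T% (S.φField X)) x :=
  MDifferentiableAt.clm_bundle_apply (b := id) (E₁ := fun x : M ↦ TangentSpace I x)
    (E₂ := fun x : M ↦ TangentSpace I x)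
    (S.contMDiff_φ.contMDiffAt.mdifferentiableAt (by simp)) hX

theorem mdifferentiableAt_η {x : M} (Y : Π x : M, TangentSpace I x) (hY : MDiffAt (T% Y) x) :
    MDiffAt (fun y ↦ S.η y (Y y)) x :=
  mdifferentiableAt_inner (S.contMDiff_ξ.contMDiffAt.mdifferentiableAt (by simp)) hY

theorem mdifferentiableAt_F {x : M} (Y Z : Π x : M, TangentSpace I x)
    (hY : MDiffAt (T% Y) x) (hZ : MDiffAt (T% Z) x) :
    MDiffAt (fun y ↦ S.F y (Y y) (Z y)) x :=
  mdifferentiableAt_inner (S.mdifferentiableAt_φField hY) hZ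

theorem η_φ (x : M) (v : TangentSpace I x) : inner ℝ (S.ξ x) (S.φ x v) = 0 := by
  have h1 := S.φ_φ x (S.φ x v)
  rw [S.φ_φ x v, map_add, map_smul, S.φ_ξ, map_neg, smul_zero, add_zero, left_eq_add] at h1
  have h2 : S.ξ x ≠ 0 := fun h ↦ by simpa [h] using S.norm_ξ x
  exact (smul_eq_zero.1 h1).resolve_right h2

theorem F_swap (x : M) (u v : TangentSpace I x) : S.F x u v = - S.F x v u := by
  have h := S.inner_φ_φ x u (S.φ x v)
  rw [S.φ_φ, S.η_φ, inner_add_right, inner_neg_right, real_inner_smul_right,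
    real_inner_comm (S.ξ x) (S.φ x u), S.η_φ, real_inner_comm (S.φ x v) u] at h
  change inner ℝ (S.φ x u) v = - inner ℝ (S.φ x v) u
  linarith

theorem torsionForm_cyclic (X Y Z : Π x : M, TangentSpace I x) (x : M) :
    S.torsionForm X Y Z x = S.torsionForm Y Z X x := by
  simp only [torsionForm]
  rw [extDerivTwo_cyclic]
  ring

theorem torsionForm_tensorial {x : M} {Y Z : Π x : M, TangentSpace I x}
    (hY : MDiffAt (T% Y) x) (hZ : MDiffAt (T% Z) x) :
    TensorialAt I E (fun X ↦ S.torsionForm X Y Z x) x where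
  smul {f X} hf hX := by
    have h1 := (extDerivOne_tensorial S.mdifferentiableAt_η Y).smul hf hX
    have h2 := (extDerivOne_tensorial S.mdifferentiableAt_η Z).smul hf hX
    have h3 := (extDerivTwo_tensorial S.mdifferentiableAt_F S.F_swap
      (S.mdifferentiableAt_φField hY) (S.mdifferentiableAt_φField hZ)).smul hf
      (S.mdifferentiableAt_φField hX)
    have e : S.φField (f • X) = f • S.φField X := by ext y; simp [φField]
    simp only [torsionForm, extDerivOne_swap S.η Z, e, h1, h2, h3, Pi.smul_apply', map_smul,
      smul_eq_mul]
    ring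
  add {X X'} hX hX' := by
    have h1 := (extDerivOne_tensorial S.mdifferentiableAt_η Y).add hX hX'
    have h2 := (extDerivOne_tensorial S.mdifferentiableAt_η Z).add hX hX'
    have h3 := (extDerivTwo_tensorial S.mdifferentiableAt_F S.F_swap
      (S.mdifferentiableAt_φField hY) (S.mdifferentiableAt_φField hZ)).add
      (S.mdifferentiableAt_φField hX) (S.mdifferentiableAt_φField hX')
    have e : S.φField (X + X') = S.φField X + S.φField X' := by ext y; simp [φField]
    simp only [torsionForm, extDerivOne_swap S.η Z, e, h1, h2, h3, Pi.add_apply, map_add]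
    ring

/-- The torsion 3-form `c` as a trilinear form on each tangent space. -/
def torsionTensor (x : M) :
    TangentSpace I x →L[ℝ] TangentSpace I x →L[ℝ] TangentSpace I x →L[ℝ] ℝ :=
  trilinearOfTensorial (fun X Y Z ↦ S.torsionForm X Y Z x) x
    (fun _ _ hY hZ ↦ S.torsionForm_tensorial hY hZ)
    (fun X Z hX hZ ↦ by
      simpa only [S.torsionForm_cyclic X] using S.torsionForm_tensorial hZ hX)
    (fun X Y hX hY ↦ by
      simpa only [← S.torsionForm_cyclic _ X Y] using S.torsionForm_tensorial hX hY)

theorem torsionTensor_apply {x : M} {X Y Z : Π x : M, TangentSpace I x}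
    (hX : MDiffAt (T% X) x) (hY : MDiffAt (T% Y) x) (hZ : MDiffAt (T% Z) x) :
    S.torsionTensor x (X x) (Y x) (Z x) = S.torsionForm X Y Z x :=
  trilinearOfTensorial_apply _ _ _ hX hY hZ

/-- The connection `∇` with `g(∇_X Y, Z) = g(∇^LC_X Y, Z) + c(X, Y, Z) / 2`; recall that `D Y x u`
is `D_u Y` at `x`. -/
def torsionConnection : CovariantDerivative I E (fun x : M ↦ TangentSpace I x) :=
  (leviCivita I M).addOneForm fun x ↦
    (2⁻¹ : ℝ) • (ContinuousLinearMap.compL ℝ (TangentSpace I x) (TangentSpace I x →L[ℝ] ℝ)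
      (TangentSpace I x) (sharp x) ∘L (S.torsionTensor x).flip)

theorem inner_torsionConnection {x : M} {X Y Z : Π x : M, TangentSpace I x}
    (hX : MDiffAt (T% X) x) (hY : MDiffAt (T% Y) x) (hZ : MDiffAt (T% Z) x) :
    inner ℝ (S.torsionConnection Y x (X x)) (Z x)
      = inner ℝ (leviCivita I M Y x (X x)) (Z x) + S.torsionForm X Y Z x / 2 := by
  rw [← S.torsionTensor_apply hX hY hZ]
  simp [torsionConnection, CovariantDerivative.addOneForm, inner_add_left, real_inner_smul_left,
    inner_sharp]
  ring

/-- The Reeb field is Killing: `L_ξ g = 0`. -/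
def IsKillingReeb : Prop :=
  ∀ (x : M) (X Y : Π y : M, TangentSpace I y), MDiffAt (T% X) x → MDiffAt (T% Y) x →
    d% (fun y ↦ inner ℝ (X y) (Y y)) x (S.ξ x) - inner ℝ (mlieBracket I S.ξ X x) (Y x)
      - inner ℝ (X x) (mlieBracket I S.ξ Y x) = 0

/-- A Sasaki with torsion (ST) structure: normal, with Killing Reeb field. -/
def IsST : Prop := S.IsNormal ∧ S.IsKillingReeb

/-- `D` is an almost contact metric connection: a smooth connection with `D g = 0`, `D ξ = 0` and
`D φ = 0`. -/
structure IsAlmostContactMetricConnection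
    (D : CovariantDerivative I E (fun x : M ↦ TangentSpace I x)) : Prop where
  smooth : CovariantDerivative.ContMDiffCovariantDerivative D ∞
  metric : PreservesMetric D
  reeb : ∀ x, D S.ξ x = 0
  endo : ∀ (x : M) (Y : Π y : M, TangentSpace I y), MDiffAt (T% Y) x →
    ∀ u : TangentSpace I x, D (S.φField Y) x u = S.φ x (D Y x u)

end AlmostContactMetric

/-- `D` has skew torsion: `(X, Y, Z) ↦ g(T(X, Y), Z)` is totally skew (it is skew in `X, Y` by
definition of `T`). -/
def HasSkewTorsion (D : CovariantDerivative I E (fun x : M ↦ TangentSpace I x)) : Prop :=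
  ∀ (x : M) (u v w : TangentSpace I x), inner ℝ (D.torsion x u v) w = - inner ℝ (D.torsion x u w) v

end

end SasakiTorsion

/-! Normality is assumed throughout, so only the Killing condition has to be traded for connections.
If `D` is metric with `D ξ = 0` and torsion `T`, then `L_ξ g (X, Y) = g(T(ξ, X), Y) + g(X, T(ξ,
Y))`, which vanishes for skew torsion (`isKillingReeb_of_connection`). The torsion of `∇` is the
3-form `c`, so this settles both converse directions.

For the direct implications `∇` itself is the required connection. It is metric because `c` is skew
in its last two arguments. The rest is pointwise algebra in `A u v = (∇^LC_u φ) v` and `B u = ∇^LC_u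
ξ`: normality and the Killing condition become identities between `A`, `B`, `φ`, `ξ`
(`IsNormalKillingAt`). Killing gives `c(u, ξ, w) = -2 g(B u, w)`, hence `∇ξ = 0`. The decisive
identity is `A_φ_left`, `A (φ u) v = φ (A u v) - g(B u, v) ξ`; with it `d^φ F` collapses to the
value that makes `∇φ = 0` (`inner_A_add_torsion`).

Smoothness of `∇` follows from the Koszul formula: all `g(∇_X Y, Z)` are smooth, and inverting the
Gram matrix of a local frame recovers `∇_X Y`. -/

namespace SasakiTorsion

/-! ### Pointwise algebra of normal structures with Killing Reeb field -/

section Algebra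

variable {V : Type*} [NormedAddCommGroup V] [InnerProductSpace ℝ V]

local notation "⟪" x ", " y "⟫" => inner ℝ x y

/-- The pointwise identities satisfied by `(ξ, φ)`, `A u v = (∇_u φ) v` and `B u = ∇_u ξ` for the
Levi-Civita connection `∇` of a normal almost contact metric structure with Killing Reeb field. -/
structure IsNormalKillingAt (ξ : V) (φ B : V →L[ℝ] V) (A : V →L[ℝ] V →L[ℝ] V) : Prop where
  inner_ξ : ⟪ξ, ξ⟫ = 1
  φ_ξ : φ ξ = 0
  φ_φ : ∀ v, φ (φ v) = -v + ⟪ξ, v⟫ • ξ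
  φ_skew : ∀ u v, ⟪φ u, v⟫ = -⟪u, φ v⟫
  A_skew : ∀ u v w, ⟪A u v, w⟫ = -⟪v, A u w⟫
  A_φ : ∀ u v, A u (φ v) = -φ (A u v) + ⟪B u, v⟫ • ξ + ⟪ξ, v⟫ • B u
  A_ξ : ∀ u, A u ξ = -φ (B u)
  B_ξ : ∀ u, ⟪B u, ξ⟫ = 0
  B_skew : ∀ u v, ⟪B u, v⟫ = -⟪u, B v⟫
  normal : ∀ u v, A (φ u) v - A (φ v) u - φ (A u v) + φ (A v u) + (⟪B u, v⟫ - ⟪B v, u⟫) • ξ = 0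

namespace IsNormalKillingAt

variable {ξ : V} {φ B : V →L[ℝ] V} {A : V →L[ℝ] V →L[ℝ] V} (h : IsNormalKillingAt ξ φ B A)
include h

theorem apply_reeb : B ξ = 0 :=
  ext_inner_right ℝ fun v ↦ by
    rw [h.B_skew, real_inner_comm, h.B_ξ, neg_zero, inner_zero_left]

theorem inner_φ_ξ (u : V) : ⟪φ u, ξ⟫ = 0 := by rw [h.φ_skew, h.φ_ξ, inner_zero_right, neg_zero]

theorem inner_A_ξ (u v : V) : ⟪A u v, ξ⟫ = -⟪B u, φ v⟫ := by
  rw [h.A_skew, h.A_ξ, inner_neg_right, neg_neg, real_inner_comm, h.φ_skew]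

theorem B_swap (u v : V) : ⟪B u, v⟫ = -⟪B v, u⟫ := by rw [h.B_skew, real_inner_comm]

theorem A_swap (u v w : V) : ⟪A u v, w⟫ = -⟪A u w, v⟫ := by rw [h.A_skew, real_inner_comm]

/-- This is the `ξ`-component of normality: `dη` is `φ`-invariant, and `dη = 2 g(B ·, ·)` because
`B` is skew. -/
theorem inner_B_φ_φ (u v : V) : ⟪B (φ u), φ v⟫ = ⟪B u, v⟫ := by
  have e := congrArg (fun t ↦ ⟪t, ξ⟫) (h.normal u v)
  simp only [inner_add_left, inner_sub_left, real_inner_smul_left, h.inner_ξ, h.inner_φ_ξ,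
    h.inner_A_ξ, inner_zero_left] at e
  linarith [h.B_swap (φ v) (φ u), h.B_swap v u]

/-- Since `φ` is skew, this says that `B` commutes with `φ`. -/
theorem inner_B_φ (u v : V) : ⟪B (φ u), v⟫ = -⟪B u, φ v⟫ := by
  have e := h.inner_B_φ_φ u (φ v)
  rw [h.φ_φ, inner_add_right, inner_neg_right, real_inner_smul_right, h.B_ξ] at e
  linarith

theorem inner_A_φ (u v w : V) :
    ⟪A u (φ v), w⟫ = ⟪A u v, φ w⟫ + ⟪B u, v⟫ * ⟪ξ, w⟫ + ⟪ξ, v⟫ * ⟪B u, w⟫ := by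
  rw [h.A_φ, inner_add_left, inner_add_left, inner_neg_left, real_inner_smul_left,
    real_inner_smul_left, h.φ_skew, neg_neg]

/-- The defect `K` of the identity is symmetric in its first two arguments by normality, and skew in
its last two because `A u` is skew and almost anticommutes with `φ`. A trilinear form with these two
symmetries vanishes, as in the uniqueness of the Levi-Civita connection. -/
theorem A_φ_left (u v : V) : A (φ u) v = φ (A u v) - ⟪B u, v⟫ • ξ := by
  set K : V → V → V → ℝ := fun u v w ↦ ⟪A (φ u) v, w⟫ - ⟪φ (A u v), w⟫ + ⟪B u, v⟫ * ⟪ξ, w⟫ with hK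
  have hsymm (u v w : V) : K u v w = K v u w := by
    have e := congrArg (fun t ↦ ⟪t, w⟫) (h.normal u v)
    simp only [inner_add_left, inner_sub_left, real_inner_smul_left, inner_zero_left] at e
    simp only [hK]
    linarith
  have hskew (u v w : V) : K u v w = -K u w v := by
    simp only [hK, h.φ_skew]
    linarith [h.A_swap (φ u) v w, h.A_swap u v (φ w), h.inner_A_φ u w v]
  refine ext_inner_right ℝ fun w ↦ ?_
  -- Alternating the two symmetries six times returns to the same arguments with the opposite sign,
  -- so `K u v w = -K u v w`.
  have e : K u v w = 0 := by
    linarith [hsymm u v w, hskew v u w, hsymm v w u, hskew w v u, hsymm w u v, hskew u w v]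
  simp only [hK] at e
  rw [inner_sub_left, real_inner_smul_left]
  linarith

theorem inner_A_φ_left (u v w : V) :
    ⟪A (φ u) v, w⟫ = -⟪A u v, φ w⟫ - ⟪B u, v⟫ * ⟪ξ, w⟫ := by
  rw [h.A_φ_left, inner_sub_left, real_inner_smul_left, h.φ_skew]

/-- Putting `ξ` in `A_φ_left` gives `φ (A ξ u) = 0`, so `A ξ u` is a multiple of `ξ`; its
`ξ`-component is `-g(B ξ, φ u) = 0`. -/
theorem A_reeb (u : V) : A ξ u = 0 := by
  have e := h.A_φ_left ξ u
  rw [h.φ_ξ, map_zero, h.apply_reeb, inner_zero_left, zero_smul, sub_zero] at e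
  have e1 := h.φ_φ (A ξ u)
  rw [real_inner_comm, h.inner_A_ξ, h.apply_reeb, inner_zero_left, neg_zero, zero_smul, add_zero,
    ← e, _root_.zero_apply, map_zero] at e1
  exact neg_eq_zero.1 e1.symm

/-- The pointwise form of `∇φ = 0` for the connection with torsion `η ∧ dη + d^φ F`. -/
theorem inner_A_add_torsion (dη : V → V → ℝ) (dF c : V → V → V → ℝ)
    (hη : ∀ u v, dη u v = ⟪B u, v⟫ - ⟪B v, u⟫)
    (hF : ∀ u v w, dF u v w = ⟪A u v, w⟫ + ⟪A v w, u⟫ + ⟪A w u, v⟫)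
    (hc : ∀ u v w, c u v w = ⟪ξ, u⟫ * dη v w + ⟪ξ, v⟫ * dη w u + ⟪ξ, w⟫ * dη u v
      + dF (φ u) (φ v) (φ w)) (u v w : V) :
    2 * ⟪A u v, w⟫ + c u (φ v) w + c u v (φ w) = 0 := by
  have hξφ (v : V) : ⟪ξ, φ v⟫ = 0 := by rw [real_inner_comm, h.inner_φ_ξ]
  have hAξ (u v : V) : ⟪A u ξ, v⟫ = ⟪B u, φ v⟫ := by rw [h.A_swap, h.inner_A_ξ, neg_neg]
  have hAr (u v : V) : ⟪A ξ u, v⟫ = 0 := by rw [h.A_reeb, inner_zero_left]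
  have hBr (v : V) : ⟪B ξ, v⟫ = 0 := by rw [h.apply_reeb, inner_zero_left]
  -- Up to terms containing `ξ` or `B`, the two values of `dF` each contribute `-g(A u v, w)`, while
  -- the summands differentiated along `v` and `w` cancel in pairs.
  simp only [hc, hη, hF, h.inner_A_φ, h.inner_A_φ_left, h.inner_B_φ, h.φ_φ, hξφ, h.φ_ξ, map_add,
    map_neg, map_smul, inner_add_right, inner_neg_right, real_inner_smul_right, inner_zero_right,
    map_zero, h.inner_A_ξ, h.B_ξ, h.inner_ξ, _root_.add_apply, _root_.neg_apply, _root_.smul_apply,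
    inner_add_left, inner_neg_left, real_inner_smul_left, hAξ, hAr, hBr]
  -- As `B` is skew and commutes with `φ`, the form `g(B ·, φ ·)` is symmetric; this disposes of the
  -- remaining terms.
  have e (u v : V) : ⟪B v, φ u⟫ = ⟪B u, φ v⟫ := by
    linarith [h.B_swap (φ v) u, h.inner_B_φ v u]
  linear_combination ⟪ξ, w⟫ * e u v + ⟪ξ, v⟫ * e w u

end IsNormalKillingAt

end Algebra

/-! ### The structure tensors in terms of the Levi-Civita connection -/

set_option linter.unusedSectionVars false

noncomputable section

variable {E : Type*} [NormedAddCommGroup E] [NormedSpace ℝ E] [FiniteDimensional ℝ E]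
  [CompleteSpace E]
  {H : Type*} [TopologicalSpace H] {I : ModelWithCorners ℝ E H}
  {M : Type*} [TopologicalSpace M] [ChartedSpace H M] [IsManifold I ∞ M]
  [RiemannianBundle (fun x : M ↦ TangentSpace I x)]
  [IsContMDiffRiemannianBundle I ∞ E (fun x : M ↦ TangentSpace I x)]

theorem mlieBracket_eq_leviCivita_sub {x : M} {X Y : Π x : M, TangentSpace I x}
    (hX : MDiffAt (T% X) x) (hY : MDiffAt (T% Y) x) :
    mlieBracket I X Y x = leviCivita I M Y x (X x) - leviCivita I M X x (Y x) :=
  ((CovariantDerivative.torsion_eq_zero_iff _).1 leviCivita_torsion hX hY).symm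

/-- The exterior derivative of `g(ξ, ·)` is twice the skew part of `∇ξ`, for the Levi-Civita
connection `∇`. -/
theorem extDerivOne_innerSL {x : M} {ξ X Y : Π x : M, TangentSpace I x}
    (hξ : MDiffAt (T% ξ) x) (hX : MDiffAt (T% X) x) (hY : MDiffAt (T% Y) x) :
    extDerivOne (fun y ↦ innerSL ℝ (ξ y)) X Y x
      = inner ℝ (leviCivita I M ξ x (X x)) (Y x) - inner ℝ (leviCivita I M ξ x (Y x)) (X x) := by
  simp only [extDerivOne, innerSL_apply_apply]
  rw [leviCivita_preservesMetric x X ξ Y hX hξ hY, leviCivita_preservesMetric x Y ξ X hY hξ hX,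
    mlieBracket_eq_leviCivita_sub hX hY, inner_sub_right]
  ring

namespace AlmostContactMetric

variable (S : AlmostContactMetric I M)

theorem mdifferentiableAt_ξ (x : M) : MDiffAt (T% S.ξ) x :=
  S.contMDiff_ξ.contMDiffAt.mdifferentiableAt (by simp)

theorem φ_skew (x : M) (u v : TangentSpace I x) :
    inner ℝ (S.φ x u) v = - inner ℝ u (S.φ x v) := by
  rw [real_inner_comm _ u]
  exact S.F_swap x u v

theorem φField_φField (X : Π x : M, TangentSpace I x) :
    S.φField (S.φField X) = -X + (fun y ↦ inner ℝ (S.ξ y) (X y)) • S.ξ := by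
  ext y
  exact S.φ_φ y (X y)

theorem φField_ξ : S.φField S.ξ = 0 := by
  ext y
  exact S.φ_ξ y

theorem φField_add (X Y : Π x : M, TangentSpace I x) :
    S.φField (X + Y) = S.φField X + S.φField Y := by
  ext y
  exact map_add _ _ _

theorem φField_smul (f : M → ℝ) (X : Π x : M, TangentSpace I x) :
    S.φField (f • X) = f • S.φField X := by
  ext y
  exact map_smul _ _ _

/-- The covariant derivative of `φ`: `S.covDerivφ D x v u = (D_u φ) v`. -/
def covDerivφ (D : CovariantDerivative I E (fun x : M ↦ TangentSpace I x)) (x : M) :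
    TangentSpace I x →L[ℝ] TangentSpace I x →L[ℝ] TangentSpace I x :=
  TensorialAt.mkHom (I := I) (F := E) (fun Y ↦ D (S.φField Y) x - S.φ x ∘L D Y x) x
    { smul := fun {f Y} hf hY ↦ by
        rw [φField_smul, D.isCovariantDerivativeOnUniv.leibniz hY hf,
          D.isCovariantDerivativeOnUniv.leibniz (S.mdifferentiableAt_φField hY) hf]
        ext u
        simp [φField, smul_sub]
      add := fun {Y Y'} hY hY' ↦ by
        rw [φField_add, D.isCovariantDerivativeOnUniv.add hY hY',
          D.isCovariantDerivativeOnUniv.add (S.mdifferentiableAt_φField hY)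
            (S.mdifferentiableAt_φField hY')]
        ext u
        simp
        abel }

theorem apply_φField (D : CovariantDerivative I E (fun x : M ↦ TangentSpace I x)) {x : M}
    {Y : Π x : M, TangentSpace I x} (hY : MDiffAt (T% Y) x) (u : TangentSpace I x) :
    D (S.φField Y) x u = S.covDerivφ D x (Y x) u + S.φ x (D Y x u) := by
  rw [covDerivφ, TensorialAt.mkHom_apply _ hY]
  simp

variable (I M) in
theorem exists_field {x : M} (v : TangentSpace I x) :
    ∃ X : Π y : M, TangentSpace I y, X x = v ∧ MDiffAt (T% X) x :=
  ⟨extend E v, extend_apply_self .., mdifferentiableAt_extend ..⟩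

/-- `A u v = (∇_u φ) v` for the Levi-Civita connection `∇`. -/
def nablaφ (x : M) : TangentSpace I x →L[ℝ] TangentSpace I x →L[ℝ] TangentSpace I x :=
  (S.covDerivφ (leviCivita I M) x).flip

theorem leviCivita_φField {x : M} {Y : Π x : M, TangentSpace I x} (hY : MDiffAt (T% Y) x)
    (u : TangentSpace I x) :
    leviCivita I M (S.φField Y) x u = S.nablaφ x u (Y x) + S.φ x (leviCivita I M Y x u) :=
  S.apply_φField _ hY u

/-- Differentiate `g(φ V, W) = -g(V, φ W)`. -/
theorem nablaφ_skew (x : M) (u v w : TangentSpace I x) :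
    inner ℝ (S.nablaφ x u v) w = - inner ℝ v (S.nablaφ x u w) := by
  obtain ⟨U, rfl, hU⟩ := exists_field I M u
  obtain ⟨V, rfl, hV⟩ := exists_field I M v
  obtain ⟨W, rfl, hW⟩ := exists_field I M w
  have e1 := leviCivita_preservesMetric x U (S.φField V) W hU (S.mdifferentiableAt_φField hV) hW
  have e2 := leviCivita_preservesMetric x U V (S.φField W) hU hV (S.mdifferentiableAt_φField hW)
  have e : (fun y ↦ inner ℝ (S.φField V y) (W y)) = -fun y ↦ inner ℝ (V y) (S.φField W y) := by
    ext y
    exact S.φ_skew y _ _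
  rw [e, mvfderiv_neg, _root_.neg_apply, e2, S.leviCivita_φField hV, S.leviCivita_φField hW] at e1
  simp only [inner_add_left, inner_add_right, φField, S.φ_skew] at e1
  linarith

/-- Differentiate `φ² = -1 + η ⊗ ξ`. -/
theorem nablaφ_φ (x : M) (u v : TangentSpace I x) :
    S.nablaφ x u (S.φ x v) = -S.φ x (S.nablaφ x u v)
      + inner ℝ (leviCivita I M S.ξ x u) v • S.ξ x
      + inner ℝ (S.ξ x) v • leviCivita I M S.ξ x u := by
  obtain ⟨U, rfl, hU⟩ := exists_field I M u
  obtain ⟨V, rfl, hV⟩ := exists_field I M v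
  have hφ := S.mdifferentiableAt_φField hV
  have hξ := S.mdifferentiableAt_ξ x
  have hf := mdifferentiableAt_inner hξ hV
  have e1 := S.leviCivita_φField hφ (U x)
  have hm : (-V : Π y : M, TangentSpace I y) = (-1 : ℝ) • V := by simp
  have hV' : MDiffAt (T% (-V)) x := mdifferentiableAt_neg_section hV
  rw [S.leviCivita_φField hV, S.φField_φField,
    (leviCivita I M).isCovariantDerivativeOnUniv.add hV' (hf.smul_section hξ),
    (leviCivita I M).isCovariantDerivativeOnUniv.leibniz hξ hf, hm,
    (leviCivita I M).isCovariantDerivativeOnUniv.smul_const _ hV] at e1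
  simp only [_root_.add_apply, _root_.smul_apply, ContinuousLinearMap.smulRight_apply,
    leviCivita_preservesMetric x U S.ξ V hU hξ hV, map_add, S.φ_φ, φField] at e1
  linear_combination (norm := module) -e1

theorem nablaφ_ξ (x : M) (u : TangentSpace I x) :
    S.nablaφ x u (S.ξ x) = -S.φ x (leviCivita I M S.ξ x u) := by
  have e := S.leviCivita_φField (S.mdifferentiableAt_ξ x) u
  rw [φField_ξ, CovariantDerivative.zero] at e
  exact eq_neg_of_add_eq_zero_left e.symm

theorem inner_covDeriv_ξ_ξ (D : CovariantDerivative I E (fun x : M ↦ TangentSpace I x))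
    (hD : PreservesMetric D) (x : M) (u : TangentSpace I x) :
    inner ℝ (D S.ξ x u) (S.ξ x) = 0 := by
  obtain ⟨U, rfl, hU⟩ := exists_field I M u
  have hξ := S.mdifferentiableAt_ξ x
  have e := hD x U S.ξ S.ξ hU hξ hξ
  have e1 : (fun y ↦ inner ℝ (S.ξ y) (S.ξ y)) = fun _ ↦ (1 : ℝ) := by
    ext y
    rw [real_inner_self_eq_norm_sq, S.norm_ξ, one_pow]
  rw [e1, mvfderiv_const, real_inner_comm (D S.ξ x (U x)) (S.ξ x)] at e
  simp at e
  linarith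

theorem extDerivOne_η {x : M} {X Y : Π x : M, TangentSpace I x}
    (hX : MDiffAt (T% X) x) (hY : MDiffAt (T% Y) x) :
    extDerivOne S.η X Y x = inner ℝ (leviCivita I M S.ξ x (X x)) (Y x)
      - inner ℝ (leviCivita I M S.ξ x (Y x)) (X x) :=
  extDerivOne_innerSL (S.mdifferentiableAt_ξ x) hX hY

theorem extDerivTwo_F {x : M} {X Y Z : Π x : M, TangentSpace I x}
    (hX : MDiffAt (T% X) x) (hY : MDiffAt (T% Y) x) (hZ : MDiffAt (T% Z) x) :
    extDerivTwo S.F X Y Z x = inner ℝ (S.nablaφ x (X x) (Y x)) (Z x)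
      + inner ℝ (S.nablaφ x (Y x) (Z x)) (X x) + inner ℝ (S.nablaφ x (Z x) (X x)) (Y x) := by
  have h {X Y Z : Π x : M, TangentSpace I x}
      (hX : MDiffAt (T% X) x) (hY : MDiffAt (T% Y) x) (hZ : MDiffAt (T% Z) x) :
      d% (fun y ↦ S.F y (Y y) (Z y)) x (X x)
        = inner ℝ (S.nablaφ x (X x) (Y x)) (Z x) - inner ℝ (leviCivita I M Y x (X x)) (S.φ x (Z x))
          + inner ℝ (S.φ x (Y x)) (leviCivita I M Z x (X x)) := by
    refine (leviCivita_preservesMetric x X (S.φField Y) Z hX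
      (S.mdifferentiableAt_φField hY) hZ).trans ?_
    rw [S.leviCivita_φField hY, inner_add_left, S.φ_skew]
    rfl
  have hF (u v : TangentSpace I x) : S.F x u v = - inner ℝ u (S.φ x v) := S.φ_skew x u v
  have hc (u v : TangentSpace I x) : inner ℝ (S.φ x u) v = inner ℝ v (S.φ x u) :=
    real_inner_comm _ _
  rw [extDerivTwo, h hX hY hZ, h hY hZ hX, h hZ hX hY, mlieBracket_eq_leviCivita_sub hX hY,
    mlieBracket_eq_leviCivita_sub hY hZ, mlieBracket_eq_leviCivita_sub hZ hX]
  simp only [hF, inner_sub_left, hc]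
  ring

/-- Each bracket is a difference of covariant derivatives since `∇^LC` is torsion-free. The
derivatives of `X` and `Y` cancel, and only those of `φ` and `ξ` survive. -/
theorem sasakiHatakeyama_eq {x : M} {X Y : Π x : M, TangentSpace I x}
    (hX : MDiffAt (T% X) x) (hY : MDiffAt (T% Y) x) :
    S.sasakiHatakeyama X Y x = S.nablaφ x (S.φ x (X x)) (Y x) - S.nablaφ x (S.φ x (Y x)) (X x)
      - S.φ x (S.nablaφ x (X x) (Y x)) + S.φ x (S.nablaφ x (Y x) (X x))
      + (inner ℝ (leviCivita I M S.ξ x (X x)) (Y x)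
        - inner ℝ (leviCivita I M S.ξ x (Y x)) (X x)) • S.ξ x := by
  have hX' := S.mdifferentiableAt_φField hX
  have hY' := S.mdifferentiableAt_φField hY
  rw [sasakiHatakeyama, S.extDerivOne_η hX hY, mlieBracket_eq_leviCivita_sub hX' hY',
    mlieBracket_eq_leviCivita_sub hX hY, mlieBracket_eq_leviCivita_sub hX' hY,
    mlieBracket_eq_leviCivita_sub hX hY',
    S.leviCivita_φField hX, S.leviCivita_φField hY, S.leviCivita_φField hX,
    S.leviCivita_φField hY]
  simp only [map_sub, map_add, φField]
  abel

theorem torsionForm_eq {x : M} {X Y Z : Π x : M, TangentSpace I x}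
    (hX : MDiffAt (T% X) x) (hY : MDiffAt (T% Y) x) (hZ : MDiffAt (T% Z) x) :
    S.torsionForm X Y Z x =
      (inner ℝ (S.ξ x) (X x) * (inner ℝ (leviCivita I M S.ξ x (Y x)) (Z x)
        - inner ℝ (leviCivita I M S.ξ x (Z x)) (Y x))
      + inner ℝ (S.ξ x) (Y x) * (inner ℝ (leviCivita I M S.ξ x (Z x)) (X x)
        - inner ℝ (leviCivita I M S.ξ x (X x)) (Z x))
      + inner ℝ (S.ξ x) (Z x) * (inner ℝ (leviCivita I M S.ξ x (X x)) (Y x)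
        - inner ℝ (leviCivita I M S.ξ x (Y x)) (X x)))
      + (inner ℝ (S.nablaφ x (S.φ x (X x)) (S.φ x (Y x))) (S.φ x (Z x))
        + inner ℝ (S.nablaφ x (S.φ x (Y x)) (S.φ x (Z x))) (S.φ x (X x))
        + inner ℝ (S.nablaφ x (S.φ x (Z x)) (S.φ x (X x))) (S.φ x (Y x))) := by
  rw [torsionForm, S.extDerivOne_η hY hZ, S.extDerivOne_η hZ hX, S.extDerivOne_η hX hY,
    S.extDerivTwo_F (S.mdifferentiableAt_φField hX) (S.mdifferentiableAt_φField hY)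
      (S.mdifferentiableAt_φField hZ)]
  rfl

/-- Together with `torsionForm_cyclic` this makes `c` totally skew. -/
theorem torsionForm_skew {x : M} {X Y Z : Π x : M, TangentSpace I x}
    (hX : MDiffAt (T% X) x) (hY : MDiffAt (T% Y) x) (hZ : MDiffAt (T% Z) x) :
    S.torsionForm X Y Z x = - S.torsionForm X Z Y x := by
  have h (u v w : TangentSpace I x) :
      inner ℝ (S.nablaφ x u v) w = - inner ℝ (S.nablaφ x u w) v := by
    rw [S.nablaφ_skew, real_inner_comm]
  rw [S.torsionForm_eq hX hY hZ, S.torsionForm_eq hX hZ hY, h _ (S.φ x (Z x)) (S.φ x (Y x)),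
    h _ (S.φ x (Y x)) (S.φ x (X x)), h _ (S.φ x (X x)) (S.φ x (Z x))]
  ring

/-! ### Killing Reeb fields, metric connections and skew torsion -/

theorem isKillingReeb_iff : S.IsKillingReeb ↔ ∀ (x : M) (u v : TangentSpace I x),
    inner ℝ (leviCivita I M S.ξ x u) v = - inner ℝ u (leviCivita I M S.ξ x v) := by
  have key (x : M) (X Y : Π y : M, TangentSpace I y) (hX : MDiffAt (T% X) x)
      (hY : MDiffAt (T% Y) x) :
      d% (fun y ↦ inner ℝ (X y) (Y y)) x (S.ξ x) - inner ℝ (mlieBracket I S.ξ X x) (Y x)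
        - inner ℝ (X x) (mlieBracket I S.ξ Y x)
        = inner ℝ (leviCivita I M S.ξ x (X x)) (Y x)
          + inner ℝ (X x) (leviCivita I M S.ξ x (Y x)) := by
    rw [leviCivita_preservesMetric x S.ξ X Y (S.mdifferentiableAt_ξ x) hX hY,
      mlieBracket_eq_leviCivita_sub (S.mdifferentiableAt_ξ x) hX,
      mlieBracket_eq_leviCivita_sub (S.mdifferentiableAt_ξ x) hY, inner_sub_left, inner_sub_right]
    ring
  refine ⟨fun h x u v ↦ ?_, fun h x X Y hX hY ↦ ?_⟩
  · obtain ⟨U, rfl, hU⟩ := exists_field I M u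
    obtain ⟨V, rfl, hV⟩ := exists_field I M v
    have := (key x U V hU hV).symm.trans (h x U V hU hV)
    linarith
  · rw [key x X Y hX hY, h]
    ring

/-- A metric connection with skew torsion for which the Reeb field is parallel makes it Killing. -/
theorem isKillingReeb_of_connection
    {D : CovariantDerivative I E (fun x : M ↦ TangentSpace I x)} (hD : PreservesMetric D)
    (hξ : ∀ x, D S.ξ x = 0) (hT : HasSkewTorsion D) : S.IsKillingReeb := by
  intro x X Y hX hY
  have hx := S.mdifferentiableAt_ξ x
  have e := hT x (S.ξ x) (X x) (Y x)
  rw [D.torsion_apply hx hX, D.torsion_apply hx hY, hξ] at e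
  rw [hD x S.ξ X Y hx hX hY]
  simp only [_root_.zero_apply, sub_zero, inner_sub_left] at e
  rw [real_inner_comm (mlieBracket I S.ξ Y x) (X x), real_inner_comm (D Y x (S.ξ x)) (X x)]
  linarith

theorem torsionConnection_preservesMetric : PreservesMetric S.torsionConnection := by
  intro x X Y Z hX hY hZ
  rw [leviCivita_preservesMetric x X Y Z hX hY hZ, S.inner_torsionConnection hX hY hZ,
    real_inner_comm (S.torsionConnection Z x (X x)) (Y x), S.inner_torsionConnection hX hZ hY,
    S.torsionForm_skew hX hZ hY, real_inner_comm (leviCivita I M Z x (X x)) (Y x)]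
  ring

/-- The Levi-Civita part contributes nothing, so the torsion is `(c(X, Y, Z) - c(Y, X, Z)) / 2 =
c(X, Y, Z)`. -/
theorem torsionConnection_hasSkewTorsion : HasSkewTorsion S.torsionConnection := by
  have key {x : M} {X Y Z : Π y : M, TangentSpace I y} (hX : MDiffAt (T% X) x)
      (hY : MDiffAt (T% Y) x) (hZ : MDiffAt (T% Z) x) :
      inner ℝ (S.torsionConnection.torsion x (X x) (Y x)) (Z x) = S.torsionForm X Y Z x := by
    rw [CovariantDerivative.torsion_apply _ hX hY, mlieBracket_eq_leviCivita_sub hX hY,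
      inner_sub_left, inner_sub_left, inner_sub_left, S.inner_torsionConnection hX hY hZ,
      S.inner_torsionConnection hY hX hZ, S.torsionForm_cyclic Y X Z,
      S.torsionForm_skew hX hZ hY]
    ring
  intro x u v w
  obtain ⟨U, rfl, hU⟩ := exists_field I M u
  obtain ⟨V, rfl, hV⟩ := exists_field I M v
  obtain ⟨W, rfl, hW⟩ := exists_field I M w
  rw [key hU hV hW, key hU hW hV, S.torsionForm_skew hU hV hW]

/-! ### `∇ξ = 0` and `∇φ = 0` on an ST manifold -/

variable {S}

theorem IsST.isNormalKillingAt (h : S.IsST) (x : M) :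
    IsNormalKillingAt (S.ξ x) (S.φ x) (leviCivita I M S.ξ x) (S.nablaφ x) where
  inner_ξ := by rw [real_inner_self_eq_norm_sq, S.norm_ξ, one_pow]
  φ_ξ := S.φ_ξ x
  φ_φ := S.φ_φ x
  φ_skew := S.φ_skew x
  A_skew := S.nablaφ_skew x
  A_φ := S.nablaφ_φ x
  A_ξ := S.nablaφ_ξ x
  B_ξ := S.inner_covDeriv_ξ_ξ _ leviCivita_preservesMetric x
  B_skew := S.isKillingReeb_iff.1 h.2 x
  normal u v := by
    obtain ⟨U, rfl, hU⟩ := exists_field I M u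
    obtain ⟨V, rfl, hV⟩ := exists_field I M v
    rw [← S.sasakiHatakeyama_eq hU hV, h.1 x U V hU hV]

/-- As `φ ξ = 0`, the term `d^φ F` drops out of `c(X, ξ, Z)`. What remains is `dη(Z, X) = -2
g(∇^LC_X ξ, Z)`, because `B ξ = 0` and `B` is skew. -/
theorem IsST.torsionConnection_ξ (h : S.IsST) (x : M) : S.torsionConnection S.ξ x = 0 := by
  have hx := S.mdifferentiableAt_ξ x
  have hp := h.isNormalKillingAt x
  refine ext_fields fun X Z hX hZ ↦ ?_
  rw [S.inner_torsionConnection hX hx hZ, S.torsionForm_eq hX hx hZ]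
  simp only [hp.φ_ξ, hp.inner_ξ, hp.apply_reeb, hp.B_ξ, map_zero, inner_zero_left,
    inner_zero_right, _root_.zero_apply]
  rw [hp.B_swap (Z x) (X x)]
  ring

theorem IsST.torsionConnection_φField (h : S.IsST) {x : M} {Y : Π y : M, TangentSpace I y}
    (hY : MDiffAt (T% Y) x) (u : TangentSpace I x) :
    S.torsionConnection (S.φField Y) x u = S.φ x (S.torsionConnection Y x u) := by
  have hp := h.isNormalKillingAt x
  suffices e : S.torsionConnection (S.φField Y) x = S.φ x ∘L S.torsionConnection Y x from
    congrArg (fun L ↦ L u) e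
  refine ext_fields fun X Z hX hZ ↦ ?_
  have hY' := S.mdifferentiableAt_φField hY
  have hZ' := S.mdifferentiableAt_φField hZ
  -- The functions `dη`, `dF` and `c` are found by unification: the `rfl` proofs set them to their
  -- expressions in `A` and `B`, which is the form given by `torsionForm_eq`.
  have e := hp.inner_A_add_torsion _ _ _ (fun _ _ ↦ rfl) (fun _ _ _ ↦ rfl) (fun _ _ _ ↦ rfl)
    (X x) (Y x) (Z x)
  have e1 := S.inner_torsionConnection hX hY hZ'
  have e2 := S.torsionForm_eq hX hY' hZ
  have e3 := S.torsionForm_eq hX hY hZ'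
  simp only [φField] at e1 e2 e3
  rw [S.inner_torsionConnection hX hY' hZ, S.leviCivita_φField hY, ContinuousLinearMap.comp_apply,
    S.φ_skew x (S.torsionConnection Y x (X x)), e1, inner_add_left, S.φ_skew, e2, e3]
  linarith

end AlmostContactMetric

/-! ### Smoothness of the connection -/

variable {x₀ : M}

theorem contMDiffAt_inner {X Y : Π x : M, TangentSpace I x}
    (hX : CMDiffAt ∞ (T% X) x₀) (hY : CMDiffAt ∞ (T% Y) x₀) :
    CMDiffAt ∞ (fun y ↦ inner ℝ (X y) (Y y)) x₀ :=
  ContMDiffAt.inner_bundle (E := fun x : M ↦ TangentSpace I x) (b := id) hX hY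

theorem contMDiffAt_mvfderiv_apply {f : M → ℝ} {X : Π x : M, TangentSpace I x}
    (hf : CMDiffAt ∞ f x₀) (hX : CMDiffAt ∞ (T% X) x₀) :
    CMDiffAt ∞ (fun y ↦ d% f y (X y)) x₀ := by
  have h := ContMDiffAt.clm_apply_of_inCoordinates (b₁ := id) (b₂ := f) (F₁ := E) (F₂ := ℝ)
    (E₁ := fun x : M ↦ TangentSpace I x) (E₂ := fun x : ℝ ↦ TangentSpace 𝓘(ℝ, ℝ) x)
    (ϕ := fun y ↦ mfderiv% f y) (v := X) (hf.mfderiv_const (by simp)) hX hf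
  exact (contMDiff_snd_tangentBundle_modelSpace ℝ 𝓘(ℝ, ℝ)).contMDiffAt.comp x₀ h

theorem contMDiffAt_mlieBracket {X Y : Π x : M, TangentSpace I x}
    (hX : CMDiffAt ∞ (T% X) x₀) (hY : CMDiffAt ∞ (T% Y) x₀) :
    CMDiffAt ∞ (T% (mlieBracket I X Y)) x₀ := by
  have : IsManifold I ((⊤ : ℕ∞) + 1) M := by simpa using ‹IsManifold I ∞ M›
  have : IsManifold I (minSmoothness ℝ 2) M := by
    rw [minSmoothness_of_isRCLikeNormedField]
    infer_instance
  exact ContMDiffAt.mlieBracket_vectorField (m := ⊤) (n := ⊤) hX hY (by simp)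

theorem contMDiffAt_koszul {X Y Z : Π x : M, TangentSpace I x}
    (hX : CMDiffAt ∞ (T% X) x₀) (hY : CMDiffAt ∞ (T% Y) x₀) (hZ : CMDiffAt ∞ (T% Z) x₀) :
    CMDiffAt ∞ (koszul X Y Z) x₀ :=
  (((((contMDiffAt_mvfderiv_apply (contMDiffAt_inner hY hZ) hX).add
    (contMDiffAt_mvfderiv_apply (contMDiffAt_inner hX hZ) hY)).sub
    (contMDiffAt_mvfderiv_apply (contMDiffAt_inner hX hY) hZ)).add
    (contMDiffAt_inner (contMDiffAt_mlieBracket hX hY) hZ)).sub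
    (contMDiffAt_inner (contMDiffAt_mlieBracket hX hZ) hY)).sub
    (contMDiffAt_inner (contMDiffAt_mlieBracket hY hZ) hX)

theorem contMDiffAt_det {ι : Type*} [Fintype ι] [DecidableEq ι] {A : M → Matrix ι ι ℝ}
    (hA : ∀ i j, CMDiffAt ∞ (fun y ↦ A y i j) x₀) : CMDiffAt ∞ (fun y ↦ (A y).det) x₀ := by
  simp only [Matrix.det_apply']
  exact ContMDiffAt.sum fun σ _ ↦ contMDiffAt_const.mul (contMDiffAt_finsetProd fun i _ ↦ hA _ _)

/-- Cramer's rule: near `x₀` the determinant stays nonzero, and `c = det⁻¹ · adj(A) · (A c)` is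
smooth. -/
theorem contMDiffAt_of_mulVec {ι : Type*} [Fintype ι] [DecidableEq ι] {A : M → Matrix ι ι ℝ}
    (hA : ∀ i j, CMDiffAt ∞ (fun y ↦ A y i j) x₀) (hdet : (A x₀).det ≠ 0) {c : M → ι → ℝ}
    (hc : ∀ i, CMDiffAt ∞ (fun y ↦ Matrix.mulVec (A y) (c y) i) x₀) (i : ι) :
    CMDiffAt ∞ (fun y ↦ c y i) x₀ := by
  have hd := contMDiffAt_det hA
  have hne : ∀ᶠ y in nhds x₀, (A y).det ≠ 0 := hd.continuousAt.eventually_ne hdet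
  have hi : CMDiffAt ∞ (fun y ↦ (A y).det⁻¹ * ∑ j, (A y).adjugate i j *
      Matrix.mulVec (A y) (c y) j) x₀ := by
    refine (hd.inv₀ hdet).mul (ContMDiffAt.sum fun j _ ↦ ContMDiffAt.mul ?_ (hc j))
    simp only [Matrix.adjugate_apply]
    refine contMDiffAt_det fun k l ↦ ?_
    by_cases h : k = j
    · subst h
      simpa using contMDiffAt_const
    · simpa [Matrix.updateRow_apply, h] using hA k l
  refine hi.congr_of_eventuallyEq (hne.mono fun y hy ↦ ?_)
  change c y i = (A y).det⁻¹ * Matrix.mulVec (A y).adjugate (Matrix.mulVec (A y) (c y)) i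
  rw [Matrix.mulVec_mulVec, Matrix.adjugate_mul, Matrix.smul_mulVec, Matrix.one_mulVec,
    Pi.smul_apply, smul_eq_mul, inv_mul_cancel_left₀ hy]

/-- A vector field is smooth if its inner products with smooth vector fields are. -/
theorem contMDiffAt_of_inner {V : Π x : M, TangentSpace I x}
    (h : ∀ Z : Π x : M, TangentSpace I x, CMDiffAt ∞ (T% Z) x₀ →
      CMDiffAt ∞ (fun y ↦ inner ℝ (V y) (Z y)) x₀) : CMDiffAt ∞ (T% V) x₀ := by
  classical
  let e := trivializationAt E (fun x : M ↦ TangentSpace I x) x₀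
  let b := Module.finBasis ℝ E
  have hx : x₀ ∈ e.baseSet := FiberBundle.mem_baseSet_trivializationAt E _ x₀
  have hs (i) : CMDiffAt ∞ (T% (e.localFrame b i)) x₀ := contMDiffAt_localFrame_of_mem ∞ _ b i hx
  rw [contMDiffAt_iff_localFrameCoeff b hx]
  -- The Gram matrix of the local frame sends the coefficients of `V` to its inner products with the
  -- frame fields, and it is positive definite at `x₀`.
  refine contMDiffAt_of_mulVec (A := fun y ↦ Matrix.gram ℝ (fun i ↦ e.localFrame b i y))
    (c := fun y i ↦ e.localFrameCoeff I b i y (V y)) (fun i j ↦ ?_) ?_ fun j ↦ ?_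
  · exact contMDiffAt_inner (hs i) (hs j)
  · have hli := (e.isLocalFrameOn_localFrame_baseSet I 1 b).linearIndependent hx
    exact (Matrix.posDef_gram_of_linearIndependent hli).det_pos.ne'
  · refine (h _ (hs j)).congr_of_eventuallyEq ?_
    filter_upwards [e.eventually_eq_localFrame_sum_coeff_smul (I := I) (s := V) b hx] with y hy
    conv_rhs => rw [hy, sum_inner]
    change ∑ i, inner ℝ (e.localFrame b j y) (e.localFrame b i y) *
      e.localFrameCoeff I b i y (V y) = _
    refine Finset.sum_congr rfl fun i _ ↦ ?_
    rw [real_inner_smul_left, real_inner_comm]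
    exact mul_comm _ _

/-- A section of the endomorphism bundle is smooth if it maps smooth vector fields to smooth vector
fields. -/
theorem contMDiffAt_hom_of_apply {Φ : Π x : M, TangentSpace I x →L[ℝ] TangentSpace I x}
    (h : ∀ X : Π x : M, TangentSpace I x, CMDiffAt ∞ (T% X) x₀ →
      CMDiffAt ∞ (T% (fun y ↦ Φ y (X y))) x₀) :
    ContMDiffAt I (I.prod 𝓘(ℝ, E →L[ℝ] E)) ∞
      (fun x ↦ TotalSpace.mk' (E →L[ℝ] E)
        (E := fun x : M ↦ TangentSpace I x →L[ℝ] TangentSpace I x) x (Φ x)) x₀ := by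
  let e := trivializationAt E (fun x : M ↦ TangentSpace I x) x₀
  let b := Module.finBasis ℝ E
  have hx : x₀ ∈ e.baseSet := FiberBundle.mem_baseSet_trivializationAt E _ x₀
  rw [contMDiffAt_hom_bundle]
  refine ⟨contMDiffAt_id, ?_⟩
  have hs (i) := h _ (contMDiffAt_localFrame_of_mem (I := I) ∞ e b i hx)
  simp only [e.contMDiffAt_section_iff hx] at hs
  -- In the trivialization `Φ` is the sum of `bᵢ* ⊗ Φ(sᵢ)` over the local frame `sᵢ`, and each
  -- `Φ(sᵢ)` is smooth by hypothesis.
  have hsum : CMDiffAt ∞ (fun y ↦ ∑ i, ContinuousLinearMap.smulRightL ℝ E E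
      (LinearMap.toContinuousLinearMap (b.coord i)) (e ⟨y, Φ y (e.localFrame b i y)⟩).2) x₀ :=
    ContMDiffAt.sum fun i _ ↦ (ContinuousLinearMap.contMDiff _).contMDiffAt.comp x₀ (hs i)
  refine hsum.congr_of_eventuallyEq ?_
  filter_upwards [e.open_baseSet.mem_nhds hx] with y hy
  refine ContinuousLinearMap.coe_injective (b.ext fun i ↦ ?_)
  have h1 : (e.continuousLinearEquivAt ℝ y hy).symm (b i) = e.localFrame b i y := by
    rw [e.localFrame_apply_of_mem_baseSet b hy]
    rfl
  change ContinuousLinearMap.inCoordinates E _ E _ x₀ y x₀ y (Φ y) (b i) = _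
  rw [ContinuousLinearMap.inCoordinates_eq hy hy]
  change e.continuousLinearEquivAt ℝ y hy (Φ y ((e.continuousLinearEquivAt ℝ y hy).symm (b i))) = _
  rw [h1]
  simp [Finsupp.single_apply]

theorem contMDiffAt_extDerivOne {α : Π x : M, TangentSpace I x →L[ℝ] ℝ}
    (hα : ∀ Y : Π x : M, TangentSpace I x, CMDiffAt ∞ (T% Y) x₀ →
      CMDiffAt ∞ (fun y ↦ α y (Y y)) x₀) {X Y : Π x : M, TangentSpace I x}
    (hX : CMDiffAt ∞ (T% X) x₀) (hY : CMDiffAt ∞ (T% Y) x₀) :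
    CMDiffAt ∞ (extDerivOne α X Y) x₀ :=
  ((contMDiffAt_mvfderiv_apply (hα Y hY) hX).sub (contMDiffAt_mvfderiv_apply (hα X hX) hY)).sub
    (hα _ (contMDiffAt_mlieBracket hX hY))

theorem contMDiffAt_extDerivTwo {β : Π x : M, TangentSpace I x →L[ℝ] TangentSpace I x →L[ℝ] ℝ}
    (hβ : ∀ Y Z : Π x : M, TangentSpace I x, CMDiffAt ∞ (T% Y) x₀ → CMDiffAt ∞ (T% Z) x₀ →
      CMDiffAt ∞ (fun y ↦ β y (Y y) (Z y)) x₀) {X Y Z : Π x : M, TangentSpace I x}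
    (hX : CMDiffAt ∞ (T% X) x₀) (hY : CMDiffAt ∞ (T% Y) x₀) (hZ : CMDiffAt ∞ (T% Z) x₀) :
    CMDiffAt ∞ (extDerivTwo β X Y Z) x₀ :=
  (((((contMDiffAt_mvfderiv_apply (hβ Y Z hY hZ) hX).add
    (contMDiffAt_mvfderiv_apply (hβ Z X hZ hX) hY)).add
    (contMDiffAt_mvfderiv_apply (hβ X Y hX hY) hZ)).sub
    (hβ _ _ (contMDiffAt_mlieBracket hX hY) hZ)).sub
    (hβ _ _ (contMDiffAt_mlieBracket hY hZ) hX)).sub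
    (hβ _ _ (contMDiffAt_mlieBracket hZ hX) hY)

namespace AlmostContactMetric

variable (S : AlmostContactMetric I M)

theorem contMDiffAt_φField {X : Π x : M, TangentSpace I x} (hX : CMDiffAt ∞ (T% X) x₀) :
    CMDiffAt ∞ (T% (S.φField X)) x₀ :=
  ContMDiffAt.clm_bundle_apply (b := id) (E₁ := fun x : M ↦ TangentSpace I x)
    (E₂ := fun x : M ↦ TangentSpace I x) S.contMDiff_φ.contMDiffAt hX

theorem contMDiffAt_η {X : Π x : M, TangentSpace I x} (hX : CMDiffAt ∞ (T% X) x₀) :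
    CMDiffAt ∞ (fun y ↦ S.η y (X y)) x₀ :=
  contMDiffAt_inner S.contMDiff_ξ.contMDiffAt hX

theorem contMDiffAt_F {X Y : Π x : M, TangentSpace I x} (hX : CMDiffAt ∞ (T% X) x₀)
    (hY : CMDiffAt ∞ (T% Y) x₀) : CMDiffAt ∞ (fun y ↦ S.F y (X y) (Y y)) x₀ :=
  contMDiffAt_inner (S.contMDiffAt_φField hX) hY

theorem contMDiffAt_torsionForm {X Y Z : Π x : M, TangentSpace I x}
    (hX : CMDiffAt ∞ (T% X) x₀) (hY : CMDiffAt ∞ (T% Y) x₀) (hZ : CMDiffAt ∞ (T% Z) x₀) :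
    CMDiffAt ∞ (S.torsionForm X Y Z) x₀ := by
  have h {U V W : Π x : M, TangentSpace I x} (hU : CMDiffAt ∞ (T% U) x₀)
      (hV : CMDiffAt ∞ (T% V) x₀) (hW : CMDiffAt ∞ (T% W) x₀) :
      CMDiffAt ∞ (fun y ↦ S.η y (U y) * extDerivOne S.η V W y) x₀ :=
    (S.contMDiffAt_η hU).mul (contMDiffAt_extDerivOne (fun _ ↦ S.contMDiffAt_η) hV hW)
  exact (((h hX hY hZ).add (h hY hZ hX)).add (h hZ hX hY)).add
    (contMDiffAt_extDerivTwo (fun _ _ ↦ S.contMDiffAt_F) (S.contMDiffAt_φField hX)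
      (S.contMDiffAt_φField hY) (S.contMDiffAt_φField hZ))

theorem torsionConnection_contMDiff :
    CovariantDerivative.ContMDiffCovariantDerivative S.torsionConnection ∞ := by
  refine ⟨⟨fun {Y} hY x₀ _ ↦ ContMDiffAt.contMDiffWithinAt ?_⟩⟩
  have hY : CMDiff ∞ (T% Y) := by simpa [contMDiffOn_univ] using hY
  -- The formula for `g(∇_X Y, Z)` needs fields differentiable at the point where it is used. It
  -- must hold on a neighbourhood of `x₀`, while the test fields are only assumed smooth at `x₀`.
  have hd {X : Π x : M, TangentSpace I x} (hX : CMDiffAt ∞ (T% X) x₀) :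
      ∀ᶠ y in nhds x₀, MDiffAt (T% X) y :=
    ((contMDiffAt_iff_contMDiffAt_nhds (by simp)).1
      (hX.of_le (n := ∞) (m := 1) (by simp))).mono fun y hy ↦ hy.mdifferentiableAt (by simp)
  refine contMDiffAt_hom_of_apply fun X hX ↦ contMDiffAt_of_inner fun Z hZ ↦ ?_
  have h := ((contMDiffAt_koszul hX (hY x₀) hZ).div_const 2).add
    ((S.contMDiffAt_torsionForm hX (hY x₀) hZ).div_const 2)
  refine h.congr_of_eventuallyEq ?_
  filter_upwards [hd hX, hd hZ] with y hXy hZy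
  have hYy := (hY y).mdifferentiableAt (by simp)
  exact (S.inner_torsionConnection hXy hYy hZy).trans
    (congrArg (· + _) (inner_leviCivita hXy hYy hZy))

variable {S}

theorem IsST.isAlmostContactMetricConnection (h : S.IsST) :
    S.IsAlmostContactMetricConnection S.torsionConnection where
  smooth := S.torsionConnection_contMDiff
  metric := S.torsionConnection_preservesMetric
  reeb := h.torsionConnection_ξ
  endo _ _ hY u := h.torsionConnection_φField hY u

end AlmostContactMetric

end

end SasakiTorsion

/-! ### The two equivalences -/

theorem mainTheorem5 {n : ℕ} {N : Type*} [TopologicalSpace N]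
    [ChartedSpace (EuclideanSpace ℝ (Fin n)) N] [IsManifold (𝓡 n) ∞ N]
    [RiemannianBundle (fun x : N ↦ TangentSpace (𝓡 n) x)]
    [IsContMDiffRiemannianBundle (𝓡 n) ∞ (EuclideanSpace ℝ (Fin n))
      (fun x : N ↦ TangentSpace (𝓡 n) x)]
    (S : SasakiTorsion.AlmostContactMetric (𝓡 n) N) (hS : S.IsNormal) :
    (S.IsST ↔ S.IsAlmostContactMetricConnection S.torsionConnection) ∧
    (S.IsST ↔ ∃ D : CovariantDerivative (𝓡 n) (EuclideanSpace ℝ (Fin n))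
        (fun x : N ↦ TangentSpace (𝓡 n) x),
      S.IsAlmostContactMetricConnection D ∧ SasakiTorsion.HasSkewTorsion D) := by
  have key (D : CovariantDerivative (𝓡 n) (EuclideanSpace ℝ (Fin n))
      (fun x : N ↦ TangentSpace (𝓡 n) x)) (hD : S.IsAlmostContactMetricConnection D)
      (hT : SasakiTorsion.HasSkewTorsion D) : S.IsST :=
    ⟨hS, S.isKillingReeb_of_connection hD.metric hD.reeb hT⟩
  exact ⟨⟨fun h ↦ h.isAlmostContactMetricConnection,
      fun h ↦ key _ h S.torsionConnection_hasSkewTorsion⟩,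
    ⟨fun h ↦ ⟨_, h.isAlmostContactMetricConnection, S.torsionConnection_hasSkewTorsion⟩,
      fun ⟨D, hD, hT⟩ ↦ key D hD hT⟩⟩
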